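/- Let $R$ be an integral domain with quotient field $K$, and let $F(R)$ be the set of nonzero fractional ideals of $R$. A star operation on $R$ is a map $\ast: F(R)\to F(R)$, $I\mapsto I^\ast$, such that for all $0\neq a\in K$ and $I,J\in F(R)$: $R^\ast=R$ and $(aI)^\ast=aI^\ast$; $I\subseteq I^\ast$, and $I\subseteq J$ implies $I^\ast\subseteq J^\ast$; $(I^{\ast})^{\ast}=I^\ast$. It is of finite type if $I^\ast=\bigcup\{J^\ast : J\in F(R),\ J\subseteq I,\ J \text{ finitely generated}\}$ for every $I\in F(R)$. A $\ast$-ideal is an $I\in F(R)$ with $I=I^\ast$; a proper $\ast$-ideal is a $\ast$-ideal $I\subsetneq R$. Ideals $I,J$ are $\ast$-comaximal if $(I+J)^\ast=R$, and $\ast$-invertible $I$ are those with $(I\,(R:I))^\ast=R$, where $(R:I)=\{x\in K : xI\subseteq R\}$. $\ast\text{-}\mathrm{Spec}(R)$ is the set of prime ideals that are $\ast$-ideals, and it is called treed if any two incomparable members of it are $\ast$-comaximal. A $\ast$-packet is a $\ast$-invertible $\ast$-ideal $I\subseteq R$ with a unique minimal prime, and $R$ is a $\ast$-URD if every proper $\ast$-invertible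 $\ast$-ideal $I$ can be written, uniquely up to the order of the factors, as $I=(X_1X_2\cdots X_n)^\ast$ with pairwise $\ast$-comaximal $\ast$-packets $X_1,\dots,X_n$. **Theorem.** Let $R$ be an integral domain and let $\ast$ be a star operation of finite type on $R$. The following conditions are equivalent: (i) $\ast\text{-}\mathrm{Spec}(R)$ is treed and each proper $\ast$-ideal of $R$ has finitely many minimal primes; (ii) each proper $\ast$-ideal $I$ of $R$ can be written in the form $I=(Q_1Q_2\cdots Q_n)^\ast$, where the $Q_i$ are pairwise $\ast$-comaximal (integral) $\ast$-ideals with prime radical; (iii) each proper $\ast$-ideal $I$ of $R$ can be written in the form of (ii), uniquely up to the order of the factors. If these conditions hold, then $R$ is a $\ast$-URD. -/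

import Mathlib

open scoped nonZeroDivisors

/-- A star operation on a domain `R` with quotient field `K`: a map `I ↦ I^*` on the nonzero
fractional ideals of `R` satisfying the three usual axioms. It is encoded as a map on all
fractional ideals by setting `0^* = 0`; with this convention the axioms hold at `0` automatically
(and a nonzero `I` has `I^* ≠ 0`, since `I ≤ I^*`), so nothing is added or lost. -/
structure StarOperation (R : Type*) [CommRing R] [IsDomain R] (K : Type*) [Field K]
    [Algebra R K] [IsFractionRing R K] where
  toFun : FractionalIdeal R⁰ K → FractionalIdeal R⁰ K
  map_zero : toFun 0 = 0
  map_one : toFun 1 = 1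
  map_smul : ∀ (a : K) (I : FractionalIdeal R⁰ K), a ≠ 0 →
    toFun (FractionalIdeal.spanSingleton R⁰ a * I) =
      FractionalIdeal.spanSingleton R⁰ a * toFun I
  le_star : ∀ I : FractionalIdeal R⁰ K, I ≤ toFun I
  mono : ∀ I J : FractionalIdeal R⁰ K, I ≤ J → toFun I ≤ toFun J
  idem : ∀ I : FractionalIdeal R⁰ K, toFun (toFun I) = toFun I

namespace StarOperation

instance {R : Type*} [CommRing R] [IsDomain R] {K : Type*} [Field K]
    [Algebra R K] [IsFractionRing R K] :
    CoeFun (StarOperation R K) (fun _ => FractionalIdeal R⁰ K → FractionalIdeal R⁰ K) :=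
  ⟨StarOperation.toFun⟩

section

variable {R : Type*} [CommRing R] [IsDomain R] {K : Type*} [Field K]
  [Algebra R K] [IsFractionRing R K] (st : StarOperation R K)

/-- The star operation is of finite type: `I^*` is the union of the `J^*`, where `J` runs over the
nonzero finitely generated fractional ideals contained in `I`. -/
def IsFiniteType : Prop :=
  ∀ I : FractionalIdeal R⁰ K, I ≠ 0 → ∀ x : K,
    x ∈ st I ↔ ∃ J : FractionalIdeal R⁰ K,
      J ≠ 0 ∧ (J : Submodule R K).FG ∧ J ≤ I ∧ x ∈ st J

/-- An integral ideal of `R` which is a `*`-ideal: nonzero and equal to its `*`-closure. -/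
def IsStarIdeal (I : Ideal R) : Prop :=
  I ≠ ⊥ ∧ st (I : FractionalIdeal R⁰ K) = (I : FractionalIdeal R⁰ K)

/-- A proper `*`-ideal: an integral `*`-ideal different from `R`. -/
def IsProperStarIdeal (I : Ideal R) : Prop :=
  st.IsStarIdeal I ∧ I ≠ ⊤

/-- `I` and `J` are `*`-comaximal: `(I + J)^* = R`. -/
def Comaximal (I J : Ideal R) : Prop :=
  st ((I : FractionalIdeal R⁰ K) + (J : FractionalIdeal R⁰ K)) = 1

/-- `*-Spec(R)`: the set of prime ideals that are `*`-ideals. -/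
def Spec : Set (Ideal R) :=
  {P | P.IsPrime ∧ st.IsStarIdeal P}

/-- `*-Spec(R)` is treed: any two incomparable `*`-primes are `*`-comaximal. -/
def IsTreed : Prop :=
  ∀ P ∈ st.Spec, ∀ Q ∈ st.Spec, ¬ P ≤ Q → ¬ Q ≤ P → st.Comaximal P Q

/-- `I` is `*`-invertible: `(I I⁻¹)^* = R`, where `I⁻¹ = (R : I)`. -/
def IsStarInvertible (I : Ideal R) : Prop :=
  st ((I : FractionalIdeal R⁰ K) * (I : FractionalIdeal R⁰ K)⁻¹) = 1

/-- A `*`-packet: a `*`-invertible integral `*`-ideal with a unique minimal prime. -/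
def IsPacket (I : Ideal R) : Prop :=
  st.IsStarIdeal I ∧ st.IsStarInvertible I ∧ ∃! P : Ideal R, P ∈ I.minimalPrimes

/-- `I` is the `*`-product `(Q₁ Q₂ ⋯ Qₙ)^*` of the finite family `s = {Q₁, …, Qₙ}` (a multiset, so
that the order of the factors does not matter), and the `Qᵢ` are pairwise `*`-comaximal. -/
def IsComaximalProduct (I : Ideal R) (s : Multiset (Ideal R)) : Prop :=
  s.Pairwise st.Comaximal ∧
    st ((s.prod : Ideal R) : FractionalIdeal R⁰ K) = (I : FractionalIdeal R⁰ K)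

/-- `I` is the `*`-product of the members of `s`, which are pairwise `*`-comaximal `*`-ideals with
prime radical. -/
def IsPrimeRadicalFactorization (I : Ideal R) (s : Multiset (Ideal R)) : Prop :=
  (∀ Q ∈ s, st.IsStarIdeal Q ∧ Q.radical.IsPrime) ∧ st.IsComaximalProduct I s

/-- `I` is the `*`-product of the members of `s`, which are pairwise `*`-comaximal `*`-packets. -/
def IsPacketFactorization (I : Ideal R) (s : Multiset (Ideal R)) : Prop :=
  (∀ Q ∈ s, st.IsPacket Q) ∧ st.IsComaximalProduct I s

/-- `R` is a `*`-URD: every proper `*`-invertible `*`-ideal is uniquely (up to order) a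
`*`-product of finitely many pairwise `*`-comaximal `*`-packets. -/
def IsURD : Prop :=
  ∀ I : Ideal R, st.IsProperStarIdeal I → st.IsStarInvertible I →
    ∃! s : Multiset (Ideal R), st.IsPacketFactorization I s

end

end StarOperation

namespace StarOperation

/-! The `component` of `I` at a prime `P` stands in for the contraction of a localization, with the
multipliers being ideals `*`-comaximal with `P`. Finite type lets `*`-comaximality be tested on
radicals (`Comaximal.of_radical`) and keeps components `*`-closed.

If `*-Spec(R)` is treed and `I` has finitely many minimal primes, these are pairwise `*`-comaximal
`*`-primes. The component at each has that prime as radical, and the components intersect in `I`.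
Being pairwise `*`-comaximal, they have an intersection contained in the closure of their product.

Conversely, the radicals of the factors of `I` include all its minimal primes, and factoring `P ⊓ Q`
separates incomparable `*`-primes. Uniqueness holds because each factor `Q` is forced to be the
component of `I` at `Q.radical`. For the URD property, a `*`-factor of a `*`-invertible ideal is
`*`-invertible. -/

theorem finset_inf_minimalPrimes {R : Type*} [CommRing R] {I : Ideal R}
    (hfin : I.minimalPrimes.Finite) :
    hfin.toFinset.inf id = I.radical := by
  rw [← Ideal.sInf_minimalPrimes, Finset.inf_id_eq_sInf, Set.Finite.coe_toFinset]

theorem existsUnique_minimalPrime_of_radical_isPrime {R : Type*} [CommRing R] {Q : Ideal R}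
    (h : Q.radical.IsPrime) :
    ∃! P : Ideal R, P ∈ Q.minimalPrimes := by
  rw [← Ideal.radical_minimalPrimes, Ideal.minimalPrimes_eq_subsingleton_self]
  exact ⟨Q.radical, rfl, fun _ hP => hP⟩

section

variable {R : Type*} [CommRing R] [IsDomain R] {K : Type*} [Field K]
  [Algebra R K] [IsFractionRing R K] (st : StarOperation R K)

/-! ### Star closure of integral ideals -/

theorem mul_star_le (I J : FractionalIdeal R⁰ K) : I * st J ≤ st (I * J) := by
  refine FractionalIdeal.mul_le.2 fun i hi j hj => ?_
  rcases eq_or_ne i 0 with rfl | hi0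
  · rw [zero_mul]
    exact (st (I * J)).val.zero_mem
  · have h : st (FractionalIdeal.spanSingleton R⁰ i * J) ≤ st (I * J) :=
      st.mono _ _ (mul_le_mul_left (FractionalIdeal.spanSingleton_le_iff_mem.2 hi) J)
    refine h ?_
    rw [st.map_smul i J hi0]
    exact FractionalIdeal.mul_mem_mul (FractionalIdeal.mem_spanSingleton_self R⁰ i) hj

theorem star_mul_star_le (I J : FractionalIdeal R⁰ K) : st I * st J ≤ st (I * J) := by
  refine (st.mul_star_le _ _).trans ?_
  rw [← st.idem (I * J), mul_comm, mul_comm I J]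
  exact st.mono _ _ (st.mul_star_le _ _)

/-- The closure of an integral ideal under a star operation, as an integral ideal. -/
def closure (I : Ideal R) : Ideal R :=
  ((st (I : FractionalIdeal R⁰ K) : FractionalIdeal R⁰ K) : Submodule R K).comap
    (Algebra.linearMap R K)

theorem star_coeIdeal (I : Ideal R) :
    st (I : FractionalIdeal R⁰ K) = (st.closure I : FractionalIdeal R⁰ K) := by
  have h : st (I : FractionalIdeal R⁰ K) ≤ 1 :=
    (st.mono _ _ FractionalIdeal.coeIdeal_le_one).trans st.map_one.le
  ext x
  rw [FractionalIdeal.mem_coeIdeal]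
  constructor
  · intro hx
    obtain ⟨y, rfl⟩ := (FractionalIdeal.mem_one_iff R⁰).1 (h hx)
    exact ⟨y, hx, rfl⟩
  · rintro ⟨y, hy, rfl⟩
    exact hy

theorem le_closure (I : Ideal R) : I ≤ st.closure I := fun _ hx =>
  st.le_star _ (FractionalIdeal.mem_coeIdeal_of_mem R⁰ hx)

theorem closure_mono {I J : Ideal R} (h : I ≤ J) : st.closure I ≤ st.closure J := fun _ hx =>
  st.mono _ _ ((FractionalIdeal.coeIdeal_le_coeIdeal K).2 h) hx

theorem closure_closure (I : Ideal R) : st.closure (st.closure I) = st.closure I := by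
  apply FractionalIdeal.coeIdeal_injective (K := K)
  simp only [← star_coeIdeal, st.idem]

theorem closure_le_iff {I J : Ideal R} (hJ : st.closure J = J) : st.closure I ≤ J ↔ I ≤ J :=
  ⟨(st.le_closure I).trans, fun h => (st.closure_mono h).trans hJ.le⟩

theorem closure_mul_le (I J : Ideal R) : st.closure I * st.closure J ≤ st.closure (I * J) := by
  rw [← FractionalIdeal.coeIdeal_le_coeIdeal K, FractionalIdeal.coeIdeal_mul, ← star_coeIdeal,
    ← star_coeIdeal, ← star_coeIdeal, FractionalIdeal.coeIdeal_mul]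
  exact st.star_mul_star_le _ _

theorem mul_closure_le (I J : Ideal R) : I * st.closure J ≤ st.closure (I * J) :=
  (mul_le_mul_left (st.le_closure I) _).trans (st.closure_mul_le I J)

theorem closure_pow_le (I : Ideal R) (n : ℕ) : st.closure I ^ n ≤ st.closure (I ^ n) := by
  induction n with
  | zero => simpa using st.le_closure ⊤
  | succ n ih =>
    rw [pow_succ, pow_succ]
    exact (mul_le_mul_left ih _).trans (st.closure_mul_le _ _)

theorem closure_top : st.closure (⊤ : Ideal R) = ⊤ := top_le_iff.1 (st.le_closure ⊤)

theorem closure_bot : st.closure (⊥ : Ideal R) = ⊥ := by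
  apply FractionalIdeal.coeIdeal_injective (K := K)
  simp [← star_coeIdeal, st.map_zero]

theorem closure_inf {I J : Ideal R} (hI : st.closure I = I) (hJ : st.closure J = J) :
    st.closure (I ⊓ J) = I ⊓ J :=
  le_antisymm (le_inf ((st.closure_le_iff hI).2 inf_le_left)
    ((st.closure_le_iff hJ).2 inf_le_right)) (st.le_closure _)

theorem isStarIdeal_iff {I : Ideal R} : st.IsStarIdeal I ↔ I ≠ ⊥ ∧ st.closure I = I := by
  rw [IsStarIdeal, star_coeIdeal, FractionalIdeal.coeIdeal_inj]

theorem comaximal_iff {I J : Ideal R} : st.Comaximal I J ↔ st.closure (I ⊔ J) = ⊤ := by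
  rw [Comaximal, ← FractionalIdeal.coeIdeal_sup, star_coeIdeal, FractionalIdeal.coeIdeal_eq_one,
    Ideal.one_eq_top]

theorem star_prod_eq_iff {I J : Ideal R} :
    st (J : FractionalIdeal R⁰ K) = (I : FractionalIdeal R⁰ K) ↔ st.closure J = I := by
  rw [star_coeIdeal, FractionalIdeal.coeIdeal_inj]

variable {st}

/-! ### Finite type and radicals -/

theorem exists_fg_of_mem_closure (hst : st.IsFiniteType) {I : Ideal R} {x : R}
    (hx : x ∈ st.closure I) : ∃ J : Ideal R, J.FG ∧ J ≤ I ∧ x ∈ st.closure J := by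
  rcases eq_or_ne I ⊥ with rfl | hI
  · exact ⟨⊥, Submodule.fg_bot, le_rfl, hx⟩
  obtain ⟨F, -, hfg, hle, hxF⟩ := (hst _ (FractionalIdeal.coeIdeal_ne_zero.2 hI) _).1 hx
  obtain ⟨J, rfl⟩ := FractionalIdeal.le_one_iff_exists_coeIdeal.1
    (hle.trans FractionalIdeal.coeIdeal_le_one)
  exact ⟨J, (FractionalIdeal.coeIdeal_fg R⁰ (IsFractionRing.injective R K) J).1 hfg,
    (FractionalIdeal.coeIdeal_le_coeIdeal K).1 hle, hxF⟩

/-- A finitely generated `F` inside the radical has a power inside `I`; finite type reduces to such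
`F`. -/
theorem closure_radical_le (hst : st.IsFiniteType) (I : Ideal R) :
    st.closure I.radical ≤ (st.closure I).radical := by
  intro x hx
  obtain ⟨F, hfg, hle, hxF⟩ := exists_fg_of_mem_closure hst hx
  obtain ⟨n, hn⟩ := Ideal.exists_pow_le_of_le_radical_of_fg hle hfg
  exact ⟨n, st.closure_mono hn (st.closure_pow_le F n (Ideal.pow_mem_pow hxF n))⟩

theorem closure_radical_of_closed (hst : st.IsFiniteType) {I : Ideal R} (hI : st.closure I = I) :
    st.closure I.radical = I.radical :=
  le_antisymm ((closure_radical_le hst I).trans_eq (by rw [hI])) (st.le_closure _)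

theorem closure_eq_top_of_radical (hst : st.IsFiniteType) {I : Ideal R}
    (h : st.closure I.radical = ⊤) : st.closure I = ⊤ :=
  Ideal.radical_eq_top.1 (top_le_iff.1 (h.symm.le.trans (closure_radical_le hst I)))

/-! ### Calculus of star-comaximality -/

theorem Comaximal.symm {I J : Ideal R} (h : st.Comaximal I J) : st.Comaximal J I := by
  rwa [comaximal_iff, sup_comm, ← comaximal_iff]

instance : Std.Symm st.Comaximal := ⟨fun _ _ => Comaximal.symm⟩

theorem Comaximal.mono {I I' J J' : Ideal R} (h : st.Comaximal I J) (hI : I ≤ I') (hJ : J ≤ J') :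
    st.Comaximal I' J' := by
  rw [comaximal_iff] at h ⊢
  exact top_le_iff.1 (h.symm.le.trans (st.closure_mono (sup_le_sup hI hJ)))

theorem comaximal_top_right (I : Ideal R) : st.Comaximal I ⊤ := by
  rw [comaximal_iff, sup_top_eq, closure_top]

theorem Comaximal.mul_right {I A B : Ideal R} (hA : st.Comaximal I A) (hB : st.Comaximal I B) :
    st.Comaximal I (A * B) := by
  rw [comaximal_iff] at hA hB ⊢
  have h := st.closure_mul_le (I ⊔ A) (I ⊔ B)
  rw [hA, hB, Ideal.top_mul] at h
  refine top_le_iff.1 (h.trans (st.closure_mono ?_))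
  rw [Ideal.sup_mul, Ideal.mul_sup A]
  exact sup_le (Ideal.mul_le_left.trans le_sup_left)
    (sup_le (Ideal.mul_le_right.trans le_sup_left) le_sup_right)

theorem comaximal_multiset_prod_right {I : Ideal R} {s : Multiset (Ideal R)}
    (h : ∀ A ∈ s, st.Comaximal I A) : st.Comaximal I s.prod := by
  induction s using Multiset.induction_on with
  | empty => simpa using comaximal_top_right I
  | cons A s ih =>
    rw [Multiset.prod_cons]
    exact (h A (Multiset.mem_cons_self _ _)).mul_right
      (ih fun B hB => h B (Multiset.mem_cons_of_mem hB))

theorem comaximal_finset_prod_right {ι : Type*} {I : Ideal R} {s : Finset ι} {f : ι → Ideal R}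
    (h : ∀ i ∈ s, st.Comaximal I (f i)) : st.Comaximal I (∏ i ∈ s, f i) :=
  comaximal_multiset_prod_right (by simpa using h)

theorem Comaximal.pow_right {I A : Ideal R} (h : st.Comaximal I A) (n : ℕ) :
    st.Comaximal I (A ^ n) := by
  rw [← Multiset.prod_replicate]
  exact comaximal_multiset_prod_right fun B hB => by rwa [Multiset.eq_of_mem_replicate hB]

theorem Comaximal.of_radical_right (hst : st.IsFiniteType) {I J : Ideal R}
    (h : st.Comaximal I J.radical) : st.Comaximal I J := by
  rw [comaximal_iff] at h ⊢
  exact closure_eq_top_of_radical hst (top_le_iff.1 (h.symm.le.trans (st.closure_mono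
    (sup_le (le_sup_left.trans Ideal.le_radical) (Ideal.radical_mono le_sup_right)))))

theorem Comaximal.of_radical (hst : st.IsFiniteType) {I J : Ideal R}
    (h : st.Comaximal I.radical J.radical) : st.Comaximal I J :=
  (h.of_radical_right hst).symm.of_radical_right hst |>.symm

theorem Comaximal.eq_top_of_le {I J : Ideal R} (h : st.Comaximal I J) (hJ : st.closure J = J)
    (hIJ : I ≤ J) : J = ⊤ := by
  rwa [comaximal_iff, sup_eq_right.2 hIJ, hJ] at h

/-- Multiply `I ⊓ J` by `I ⊔ J`, whose closure is `R`: the product lies in `I * J`. -/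
theorem Comaximal.inf_le {I J : Ideal R} (h : st.Comaximal I J) :
    I ⊓ J ≤ st.closure (I * J) := by
  rw [comaximal_iff] at h
  have h1 := st.mul_closure_le (I ⊓ J) (I ⊔ J)
  rw [h, Ideal.mul_top] at h1
  refine h1.trans (st.closure_mono ?_)
  rw [Ideal.mul_sup]
  exact sup_le ((mul_le_mul_left inf_le_right _).trans_eq (mul_comm _ _))
    (mul_le_mul_left inf_le_left _)

theorem finset_inf_le_closure_prod {ι : Type*} {s : Finset ι} {f : ι → Ideal R}
    (h : ∀ i ∈ s, ∀ j ∈ s, i ≠ j → st.Comaximal (f i) (f j)) :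
    s.inf f ≤ st.closure (∏ i ∈ s, f i) := by
  classical
  induction s using Finset.induction_on with
  | empty => simp [closure_top]
  | insert a s ha ih =>
    rw [Finset.inf_insert, Finset.prod_insert ha]
    have hc : st.Comaximal (f a) (∏ i ∈ s, f i) := comaximal_finset_prod_right fun i hi =>
      h a (Finset.mem_insert_self _ _) i (Finset.mem_insert_of_mem hi) (by rintro rfl; exact ha hi)
    have ih' := ih fun i hi j hj =>
      h i (Finset.mem_insert_of_mem hi) j (Finset.mem_insert_of_mem hj)
    refine (inf_le_inf_left _ ih').trans ((hc.mono le_rfl (st.le_closure _)).inf_le.trans ?_)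
    exact (st.closure_mono (st.mul_closure_le _ _)).trans_eq (st.closure_closure _)

/-! ### Components of an ideal at a prime -/

variable (st)

/-- The elements carried into `I` by some ideal that is `*`-comaximal with `P`. -/
def component (I P : Ideal R) : Ideal R where
  carrier := {x | ∃ J : Ideal R, st.Comaximal P J ∧ ∀ y ∈ J, x * y ∈ I}
  zero_mem' := ⟨⊤, comaximal_top_right P, fun y _ => by simp⟩
  add_mem' := by
    rintro a b ⟨A, hA, ha⟩ ⟨B, hB, hb⟩
    refine ⟨A * B, hA.mul_right hB, fun y hy => ?_⟩
    rw [add_mul]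
    exact add_mem (ha y (Ideal.mul_le_left hy)) (hb y (Ideal.mul_le_right hy))
  smul_mem' := by
    rintro c x ⟨J, hJ, hx⟩
    refine ⟨J, hJ, fun y hy => ?_⟩
    rw [smul_eq_mul, mul_assoc]
    exact I.mul_mem_left c (hx y hy)

theorem le_component (I P : Ideal R) : I ≤ st.component I P := fun _ hx =>
  ⟨⊤, comaximal_top_right P, fun y _ => I.mul_mem_right y hx⟩

variable {st}

theorem exists_mul_le_of_fg_le_component {I P F : Ideal R} (hF : F.FG)
    (h : F ≤ st.component I P) : ∃ J : Ideal R, st.Comaximal P J ∧ F * J ≤ I := by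
  classical
  obtain ⟨S, rfl⟩ := hF
  have h' : ∀ x : R, ∃ J : Ideal R, st.Comaximal P J ∧ (x ∈ S → ∀ y ∈ J, x * y ∈ I) := by
    intro x
    by_cases hx : x ∈ S
    · obtain ⟨J, hJ, hxJ⟩ := h (Ideal.subset_span hx)
      exact ⟨J, hJ, fun _ => hxJ⟩
    · exact ⟨⊤, comaximal_top_right P, fun h => absurd h hx⟩
  choose J hJ hxJ using h'
  refine ⟨∏ x ∈ S, J x, comaximal_finset_prod_right fun x _ => hJ x, ?_⟩
  refine Ideal.mul_le.2 fun r hr y hy => ?_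
  have hle : Ideal.span (S : Set R) ≤ Submodule.colon I {y} := by
    refine Ideal.span_le.2 fun x hx => ?_
    rw [SetLike.mem_coe, Submodule.mem_colon_singleton, smul_eq_mul]
    exact hxJ x hx y ((Finset.inf_le hx : S.inf J ≤ J x) (Ideal.prod_le_inf hy))
  simpa [Submodule.mem_colon_singleton] using hle hr

theorem closure_component (hst : st.IsFiniteType) {I P : Ideal R} (hI : st.closure I = I) :
    st.closure (st.component I P) = st.component I P := by
  refine le_antisymm (fun x hx => ?_) (st.le_closure _)
  obtain ⟨F, hfg, hle, hxF⟩ := exists_fg_of_mem_closure hst hx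
  obtain ⟨J, hJ, hFJ⟩ := exists_mul_le_of_fg_le_component hfg hle
  refine ⟨J, hJ, fun y hy => ?_⟩
  rw [← hI]
  exact st.closure_mono hFJ (st.closure_mul_le _ _ (Ideal.mul_mem_mul hxF (st.le_closure J hy)))

theorem component_le {I P : Ideal R} [P.IsPrime] (hP : st.closure P = P) (hIP : I ≤ P) :
    st.component I P ≤ P := by
  rintro x ⟨J, hJ, hx⟩
  by_contra hxP
  refine Ideal.IsPrime.ne_top ‹_› (hJ.symm.eq_top_of_le hP fun y hy => ?_)
  exact (Ideal.IsPrime.mem_or_mem ‹_› (hIP (hx y hy))).resolve_left hxP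

/-- By finite type, finitely many elements of `P ⊔ J` already have `1` in their closure; only their
`J`-parts are kept. -/
theorem exists_fg_le_comaximal (hst : st.IsFiniteType) {P J : Ideal R} (h : st.Comaximal P J) :
    ∃ F : Ideal R, F.FG ∧ F ≤ J ∧ st.Comaximal P F := by
  rw [comaximal_iff] at h
  obtain ⟨F, hfg, hle, hF⟩ := exists_fg_of_mem_closure hst ((Ideal.eq_top_iff_one _).1 h)
  obtain ⟨A, B, hA, hB, hBfg, hAB⟩ : ∃ A B : Ideal R, A ≤ P ∧ B ≤ J ∧ B.FG ∧ F ≤ A ⊔ B := by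
    classical
    obtain ⟨S, rfl⟩ := hfg
    have h' : ∀ x : R, ∃ b : R, b ∈ J ∧ (x ∈ S → x - b ∈ P) := by
      intro x
      by_cases hx : x ∈ S
      · obtain ⟨a, ha, b, hb, hab⟩ := Submodule.mem_sup.1 (hle (Ideal.subset_span hx))
        exact ⟨b, hb, fun _ => by rw [← hab]; simpa using ha⟩
      · exact ⟨0, zero_mem _, fun h => absurd h hx⟩
    choose b hb hbP using h'
    refine ⟨P, Ideal.span (S.image b : Finset R), le_rfl, ?_, ⟨_, rfl⟩, ?_⟩
    · refine Ideal.span_le.2 fun y hy => ?_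
      obtain ⟨x, -, rfl⟩ := Finset.mem_image.1 hy
      exact hb x
    · refine Ideal.span_le.2 fun x hx => ?_
      rw [← sub_add_cancel x (b x)]
      exact Submodule.add_mem_sup (hbP x hx)
        (Ideal.subset_span (Finset.mem_coe.2 (Finset.mem_image_of_mem b hx)))
  refine ⟨B, hBfg, hB, ?_⟩
  rw [comaximal_iff, Ideal.eq_top_iff_one]
  exact st.closure_mono (hAB.trans (sup_le_sup_right hA B)) hF

/-- After shrinking `J` to a finitely generated `F`, some power of `x F` lies in `I`, so `F ^ n`
witnesses that `x ^ n` is in the component. -/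
theorem le_radical_component (hst : st.IsFiniteType) {I P J : Ideal R} (hPJ : st.Comaximal P J)
    (h : P * J ≤ I.radical) : P ≤ (st.component I P).radical := by
  intro x hx
  obtain ⟨F, hfg, hFJ, hF⟩ := exists_fg_le_comaximal hst hPJ
  have hle : Ideal.span {x} * F ≤ I.radical :=
    (mul_le_mul' ((Ideal.span_singleton_le_iff_mem P).2 hx) hFJ).trans h
  obtain ⟨n, hn⟩ := Ideal.exists_pow_le_of_le_radical_of_fg hle
    (Submodule.FG.mul ⟨{x}, by simp⟩ hfg)
  refine ⟨n, F ^ n, hF.pow_right n, fun y hy => hn ?_⟩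
  rw [mul_pow]
  exact Ideal.mul_mem_mul (Ideal.pow_mem_pow (Ideal.mem_span_singleton_self x) n) hy

theorem finset_inf_component_le (hst : st.IsFiniteType) {I : Ideal R} (hI : st.closure I = I)
    {S : Finset (Ideal R)} (hS : S.inf id ≤ I.radical) : S.inf (st.component I) ≤ I := by
  classical
  intro x hx
  have h' : ∀ P : Ideal R, ∃ J : Ideal R, P ∈ S → st.Comaximal P J ∧ ∀ y ∈ J, x * y ∈ I := by
    intro P
    by_cases hP : P ∈ S
    · obtain ⟨J, hJ⟩ := (Finset.inf_le hP : S.inf (st.component I) ≤ st.component I P) hx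
      exact ⟨J, fun _ => hJ⟩
    · exact ⟨⊤, fun h => absurd h hP⟩
  choose J hJ using h'
  have hle : S.sup J ≤ Submodule.colon I {x} := by
    refine Finset.sup_le fun P hP y hy => ?_
    rw [Submodule.mem_colon_singleton, smul_eq_mul, mul_comm]
    exact (hJ P hP).2 y hy
  have hprod : st.Comaximal (S.sup J) (∏ P ∈ S, P) := comaximal_finset_prod_right fun P hP =>
    ((hJ P hP).1.mono le_rfl (Finset.le_sup hP)).symm
  -- The colon ideal contains both `S.sup J` and `I`, which are `*`-comaximal, so its closure is `R`
  -- and `x` lies in the closure of `I`.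
  have hcom : st.Comaximal (Submodule.colon I {x}) (Submodule.colon I {x}) := by
    refine ((hprod.mono le_rfl (Ideal.prod_le_inf.trans hS)).of_radical_right hst).mono hle ?_
    exact fun y hy => Submodule.mem_colon_singleton.2 (I.mul_mem_right x hy)
  rw [comaximal_iff, sup_idem] at hcom
  have h1 := st.mul_closure_le (Ideal.span {x}) (Submodule.colon I {x})
  rw [hcom, Ideal.mul_top] at h1
  rw [← hI]
  refine st.closure_mono ?_ (h1 (Ideal.mem_span_singleton_self x))
  refine Ideal.span_singleton_mul_le_iff.2 fun y hy => ?_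
  rw [mul_comm]
  exact Submodule.mem_colon_singleton.1 hy

/-! ### Uniqueness of factorizations -/

theorem IsPrimeRadicalFactorization.comaximal {I : Ideal R} {s : Multiset (Ideal R)}
    (h : st.IsPrimeRadicalFactorization I s) {Q Q' : Ideal R} (hQ : Q ∈ s) (hQ' : Q' ∈ s)
    (hne : Q ≠ Q') : st.Comaximal Q Q' :=
  h.2.1.forall hQ hQ' hne

theorem IsPrimeRadicalFactorization.ne_top {I : Ideal R} {s : Multiset (Ideal R)}
    (h : st.IsPrimeRadicalFactorization I s) {Q : Ideal R} (hQ : Q ∈ s) : Q ≠ ⊤ := fun hQt =>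
  (h.1 Q hQ).2.ne_top (by rw [hQt, Ideal.radical_top])

theorem IsPrimeRadicalFactorization.closure_eq {I : Ideal R} {s : Multiset (Ideal R)}
    (h : st.IsPrimeRadicalFactorization I s) {Q : Ideal R} (hQ : Q ∈ s) : st.closure Q = Q :=
  (st.isStarIdeal_iff.1 (h.1 Q hQ).1).2

theorem IsPrimeRadicalFactorization.closure_prod {I : Ideal R} {s : Multiset (Ideal R)}
    (h : st.IsPrimeRadicalFactorization I s) : st.closure s.prod = I :=
  st.star_prod_eq_iff.1 h.2.2

theorem IsPrimeRadicalFactorization.le {I : Ideal R} {s : Multiset (Ideal R)}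
    (h : st.IsPrimeRadicalFactorization I s) {Q : Ideal R} (hQ : Q ∈ s) : I ≤ Q := by
  rw [← h.closure_prod, st.closure_le_iff (h.closure_eq hQ)]
  exact Ideal.multiset_prod_le_inf.trans (Multiset.inf_le hQ)

theorem IsPrimeRadicalFactorization.exists_radical_le {I : Ideal R} {s : Multiset (Ideal R)}
    (h : st.IsPrimeRadicalFactorization I s) {P : Ideal R} (hP : P.IsPrime) (hIP : I ≤ P) :
    ∃ Q ∈ s, Q.radical ≤ P := by
  have hle : s.prod ≤ P := ((st.le_closure _).trans_eq h.closure_prod).trans hIP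
  obtain ⟨Q, hQ, hQP⟩ := hP.multiset_prod_le.1 hle
  exact ⟨Q, hQ, hP.radical_le_iff.2 hQP⟩

theorem IsPrimeRadicalFactorization.eq_of_radical_le (hst : st.IsFiniteType) {I : Ideal R}
    {s : Multiset (Ideal R)} (h : st.IsPrimeRadicalFactorization I s) {Q Q' : Ideal R}
    (hQ : Q ∈ s) (hQ' : Q' ∈ s) (hle : Q.radical ≤ Q'.radical) : Q = Q' := by
  by_contra hne
  refine (h.1 Q' hQ').2.ne_top
    (((h.comaximal hQ hQ' hne).mono Ideal.le_radical Ideal.le_radical).eq_top_of_le ?_ hle)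
  exact closure_radical_of_closed hst (h.closure_eq hQ')

theorem pairwise_comaximal_cons {Q : Ideal R} {s : Multiset (Ideal R)}
    (h : (Q ::ₘ s).Pairwise st.Comaximal) : ∀ A ∈ s, st.Comaximal Q A := by
  induction s using Quotient.inductionOn with
  | h l =>
    have h' : Multiset.Pairwise st.Comaximal ((Q :: l : List (Ideal R)) : Multiset _) := h
    -- `Multiset.Pairwise` only provides some ordering; symmetry of comaximality makes every
    -- ordering work.
    rw [Multiset.pairwise_coe_iff_pairwise, List.pairwise_cons] at h'
    exact h'.1

theorem IsPrimeRadicalFactorization.nodup {I : Ideal R} {s : Multiset (Ideal R)}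
    (h : st.IsPrimeRadicalFactorization I s) : s.Nodup := by
  classical
  refine Multiset.nodup_iff_ne_cons_cons.2 fun Q t hs => ?_
  have hQ : Q ∈ s := by simp [hs]
  have hpw := h.2.1
  rw [hs] at hpw
  exact h.ne_top hQ ((pairwise_comaximal_cons hpw Q (Multiset.mem_cons_self _ _)).eq_top_of_le
    (h.closure_eq hQ) le_rfl)

/-- The product of the other factors multiplies `Q` into `I`. Conversely, a multiplier `*`-comaximal
with `Q.radical` is so with `Q`, and can be cancelled because `Q` is closed. -/
theorem IsPrimeRadicalFactorization.eq_component (hst : st.IsFiniteType) {I : Ideal R}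
    {s : Multiset (Ideal R)} (h : st.IsPrimeRadicalFactorization I s) {Q : Ideal R} (hQ : Q ∈ s) :
    Q = st.component I Q.radical := by
  obtain ⟨t, rfl⟩ := Multiset.exists_cons_of_mem hQ
  apply le_antisymm
  · intro x hx
    refine ⟨t.prod, (comaximal_multiset_prod_right (pairwise_comaximal_cons h.2.1)).mono
      Ideal.le_radical le_rfl, fun y hy => ?_⟩
    rw [← h.closure_prod, Multiset.prod_cons]
    exact st.le_closure _ (Ideal.mul_mem_mul hx hy)
  · rintro x ⟨J, hJ, hxJ⟩
    have hJQ := hJ.symm.of_radical_right hst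
    rw [comaximal_iff] at hJQ
    have h1 := st.mul_closure_le (Ideal.span {x}) (J ⊔ Q)
    rw [hJQ, Ideal.mul_top] at h1
    rw [← h.closure_eq hQ]
    refine st.closure_mono ?_ (h1 (Ideal.mem_span_singleton_self x))
    rw [Ideal.mul_sup]
    exact sup_le (Ideal.span_singleton_mul_le_iff.2 fun y hy => h.le hQ (hxJ y hy))
      Ideal.mul_le_right

/-- Passing from `s` to `t` and back gives a descending chain of radicals that returns to `Q`; hence
some factor in `t` has the same radical, and so the same component. -/
theorem IsPrimeRadicalFactorization.subset (hst : st.IsFiniteType) {I : Ideal R}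
    {s t : Multiset (Ideal R)} (hs : st.IsPrimeRadicalFactorization I s)
    (ht : st.IsPrimeRadicalFactorization I t) {Q : Ideal R} (hQ : Q ∈ s) : Q ∈ t := by
  obtain ⟨Q₁, hQ₁, hle₁⟩ := ht.exists_radical_le (hs.1 Q hQ).2
    ((hs.le hQ).trans Ideal.le_radical)
  obtain ⟨Q₂, hQ₂, hle₂⟩ := hs.exists_radical_le (ht.1 Q₁ hQ₁).2
    ((ht.le hQ₁).trans Ideal.le_radical)
  have h₂ := hs.eq_of_radical_le hst hQ₂ hQ (hle₂.trans hle₁)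
  rw [h₂] at hle₂
  rw [hs.eq_component hst hQ, le_antisymm hle₂ hle₁, ← ht.eq_component hst hQ₁]
  exact hQ₁

theorem IsPrimeRadicalFactorization.unique (hst : st.IsFiniteType) {I : Ideal R}
    {s t : Multiset (Ideal R)} (hs : st.IsPrimeRadicalFactorization I s)
    (ht : st.IsPrimeRadicalFactorization I t) : s = t :=
  (Multiset.Nodup.ext hs.nodup ht.nodup).2 fun _ => ⟨hs.subset hst ht, ht.subset hst hs⟩

/-! ### Existence of factorizations -/

/-- The closure of `P` times the product of the other minimal primes lies in the closed ideal
`I.radical`, hence in `P`, and that product is not in `P`. -/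
theorem closure_minimalPrime (hst : st.IsFiniteType) {I P : Ideal R} (hI : st.closure I = I)
    (hfin : I.minimalPrimes.Finite) (hP : P ∈ I.minimalPrimes) : st.closure P = P := by
  classical
  have hPp : P.IsPrime := hP.1.1
  refine le_antisymm ?_ (st.le_closure P)
  have hnot : ¬ ∏ P' ∈ hfin.toFinset.erase P, P' ≤ P := by
    intro h
    obtain ⟨P', hP', hle⟩ := hPp.prod_le.1 h
    obtain ⟨hne, hmem⟩ := Finset.mem_erase.1 hP'
    rw [Set.Finite.mem_toFinset] at hmem
    exact hne (le_antisymm hle (hP.2 hmem.1 hle))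
  have hmul : P * ∏ P' ∈ hfin.toFinset.erase P, P' ≤ I.radical := by
    rw [Finset.mul_prod_erase _ (fun P' => P') (hfin.mem_toFinset.2 hP),
      ← finset_inf_minimalPrimes hfin]
    exact Ideal.prod_le_inf
  have h : st.closure P * ∏ P' ∈ hfin.toFinset.erase P, P' ≤ P := by
    refine (mul_le_mul' le_rfl (st.le_closure _)).trans ((st.closure_mul_le _ _).trans ?_)
    refine ((st.closure_mono hmul).trans_eq (closure_radical_of_closed hst hI)).trans ?_
    exact hPp.radical_le_iff.2 hP.1.2
  exact (hPp.mul_le.1 h).resolve_right hnot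

theorem exists_factorization_of_treed (hst : st.IsFiniteType) (htr : st.IsTreed) {I : Ideal R}
    (hI : st.IsStarIdeal I) (hfin : I.minimalPrimes.Finite) :
    ∃ s : Multiset (Ideal R), st.IsPrimeRadicalFactorization I s := by
  classical
  obtain ⟨hI0, hIc⟩ := st.isStarIdeal_iff.1 hI
  have hcl : ∀ P ∈ I.minimalPrimes, st.closure P = P := fun P hP =>
    closure_minimalPrime hst hIc hfin hP
  have hspec : ∀ P ∈ I.minimalPrimes, P ∈ st.Spec := fun P hP =>
    ⟨hP.1.1, st.isStarIdeal_iff.2 ⟨ne_bot_of_le_ne_bot hI0 hP.1.2, hcl P hP⟩⟩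
  have hcom : ∀ P ∈ I.minimalPrimes, ∀ P' ∈ I.minimalPrimes, P ≠ P' → st.Comaximal P P' :=
    fun P hP P' hP' hne => htr P (hspec P hP) P' (hspec P' hP')
      (fun h => hne (le_antisymm h (hP'.2 hP.1 h)))
      (fun h => hne (le_antisymm (hP.2 hP'.1 h) h))
  have hrad : ∀ P ∈ I.minimalPrimes, (st.component I P).radical = P := by
    intro P hP
    have hPp : P.IsPrime := hP.1.1
    refine le_antisymm (hPp.radical_le_iff.2 (component_le (hcl P hP) hP.1.2)) ?_
    refine le_radical_component hst (J := ∏ P' ∈ hfin.toFinset.erase P, P') ?_ ?_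
    · refine comaximal_finset_prod_right fun P' hP' => ?_
      obtain ⟨hne, hmem⟩ := Finset.mem_erase.1 hP'
      exact hcom P hP P' (hfin.mem_toFinset.1 hmem) hne.symm
    · rw [Finset.mul_prod_erase _ (fun P' => P') (hfin.mem_toFinset.2 hP),
        ← finset_inf_minimalPrimes hfin]
      exact Ideal.prod_le_inf
  have hcomp : ∀ P ∈ hfin.toFinset, ∀ P' ∈ hfin.toFinset, P ≠ P' →
      st.Comaximal (st.component I P) (st.component I P') := by
    intro P hP P' hP' hne
    rw [hfin.mem_toFinset] at hP hP'
    apply Comaximal.of_radical hst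
    rw [hrad P hP, hrad P' hP']
    exact hcom P hP P' hP' hne
  refine ⟨hfin.toFinset.val.map (st.component I), ?_, ?_, ?_⟩
  · intro Q hQ
    obtain ⟨P, hP, rfl⟩ := Multiset.mem_map.1 hQ
    have hP' : P ∈ I.minimalPrimes := hfin.mem_toFinset.1 hP
    refine ⟨st.isStarIdeal_iff.2 ⟨ne_bot_of_le_ne_bot hI0 (st.le_component I P),
      closure_component hst hIc⟩, ?_⟩
    rw [hrad P hP']
    exact hP'.1.1
  · refine ⟨hfin.toFinset.toList.map (st.component I), ?_, ?_⟩
    · rw [← Multiset.map_coe, Finset.coe_toList]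
    · rw [List.pairwise_map]
      refine hfin.toFinset.nodup_toList.pairwise_of_forall_ne fun P hP P' hP' hne => ?_
      exact hcomp P (Finset.mem_toList.1 hP) P' (Finset.mem_toList.1 hP') hne
  · rw [star_prod_eq_iff]
    change st.closure (∏ P ∈ hfin.toFinset, st.component I P) = I
    apply le_antisymm
    · rw [st.closure_le_iff hIc]
      exact Ideal.prod_le_inf.trans
        (finset_inf_component_le hst hIc (finset_inf_minimalPrimes hfin).le)
    · exact (Finset.le_inf fun P _ => st.le_component I P).trans
        (finset_inf_le_closure_prod hcomp)

/-! ### From factorizations back to the spectrum -/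

theorem IsPrimeRadicalFactorization.finite_minimalPrimes {I : Ideal R}
    {s : Multiset (Ideal R)} (h : st.IsPrimeRadicalFactorization I s) :
    I.minimalPrimes.Finite := by
  classical
  refine (s.toFinset.image Ideal.radical).finite_toSet.subset fun P hP => ?_
  obtain ⟨Q, hQ, hle⟩ := h.exists_radical_le hP.1.1 hP.1.2
  have : P ≤ Q.radical := hP.2 ⟨(h.1 Q hQ).2, (h.le hQ).trans Ideal.le_radical⟩ hle
  rw [Finset.mem_coe, Finset.mem_image]
  exact ⟨Q, Multiset.mem_toFinset.2 hQ, le_antisymm hle this⟩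

theorem isTreed_of_exists_factorization
    (h : ∀ I : Ideal R, st.IsProperStarIdeal I →
      ∃ s : Multiset (Ideal R), st.IsPrimeRadicalFactorization I s) : st.IsTreed := by
  rintro P ⟨hPp, hP⟩ Q ⟨hQp, hQ⟩ hPQ hQP
  obtain ⟨hP0, hPc⟩ := st.isStarIdeal_iff.1 hP
  obtain ⟨hQ0, hQc⟩ := st.isStarIdeal_iff.1 hQ
  have hne : P ⊓ Q ≠ ⊥ := fun h0 =>
    (mul_ne_zero hP0 hQ0) (le_bot_iff.1 (Ideal.mul_le_inf.trans h0.le))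
  obtain ⟨s, hs⟩ := h (P ⊓ Q) ⟨st.isStarIdeal_iff.2 ⟨hne, st.closure_inf hPc hQc⟩,
    fun ht => hPp.ne_top (top_le_iff.1 (ht.symm.le.trans inf_le_left))⟩
  obtain ⟨A, hA, hAP⟩ := hs.exists_radical_le hPp inf_le_left
  obtain ⟨B, hB, hBQ⟩ := hs.exists_radical_le hQp inf_le_right
  -- A common factor would have a prime radical containing `P ⊓ Q`, hence `P` or `Q`, making them
  -- comparable.
  have hAB : A ≠ B := by
    rintro rfl
    rcases (hs.1 A hA).2.inf_le.1 ((hs.le hA).trans Ideal.le_radical) with h1 | h1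
    · exact hPQ (h1.trans hBQ)
    · exact hQP (h1.trans hAP)
  exact (hs.comaximal hA hB hAB).mono (Ideal.le_radical.trans hAP) (Ideal.le_radical.trans hBQ)

/-! ### Packets and the URD property -/

theorem IsPacket.radical_isPrime {Q : Ideal R} (h : st.IsPacket Q) : Q.radical.IsPrime := by
  obtain ⟨P, hP, huniq⟩ := h.2.2
  have : Q.minimalPrimes = {P} := Set.eq_singleton_iff_unique_mem.2 ⟨hP, huniq⟩
  rw [← Ideal.sInf_minimalPrimes, this, sInf_singleton]
  exact hP.1.1

theorem IsPacketFactorization.isPrimeRadicalFactorization {I : Ideal R}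
    {s : Multiset (Ideal R)} (h : st.IsPacketFactorization I s) :
    st.IsPrimeRadicalFactorization I s :=
  ⟨fun Q hQ => ⟨(h.1 Q hQ).1, (h.1 Q hQ).radical_isPrime⟩, h.2⟩

/-- Since `J I⁻¹ ⊆ Q⁻¹`, the ideal `I I⁻¹ = (Q J)^* I⁻¹` lies in `(Q Q⁻¹)^*`. -/
theorem IsStarInvertible.of_closure_mul_eq {I Q J : Ideal R} (hI : st.IsStarInvertible I)
    (hI0 : I ≠ ⊥) (h : st.closure (Q * J) = I) : st.IsStarInvertible Q := by
  have hQ0 : Q ≠ ⊥ := by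
    rintro rfl
    rw [Ideal.bot_mul, closure_bot] at h
    exact hI0 h.symm
  have hIle : (I : FractionalIdeal R⁰ K) * (I : FractionalIdeal R⁰ K)⁻¹ ≤ 1 :=
    FractionalIdeal.mul_le.2 fun x hx y hy => by
      rw [mul_comm]
      exact (FractionalIdeal.mem_inv_iff (FractionalIdeal.coeIdeal_ne_zero.2 hI0)).1 hy x hx
  have hQle : (Q : FractionalIdeal R⁰ K) * (Q : FractionalIdeal R⁰ K)⁻¹ ≤ 1 :=
    FractionalIdeal.mul_le.2 fun x hx y hy => by
      rw [mul_comm]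
      exact (FractionalIdeal.mem_inv_iff (FractionalIdeal.coeIdeal_ne_zero.2 hQ0)).1 hy x hx
  have hQJ : (Q : FractionalIdeal R⁰ K) * J ≤ I := by
    rw [← FractionalIdeal.coeIdeal_mul, FractionalIdeal.coeIdeal_le_coeIdeal, ← h]
    exact st.le_closure _
  have hJinv : (J : FractionalIdeal R⁰ K) * (I : FractionalIdeal R⁰ K)⁻¹ ≤
      (Q : FractionalIdeal R⁰ K)⁻¹ := by
    intro z hz
    refine (FractionalIdeal.mem_inv_iff (FractionalIdeal.coeIdeal_ne_zero.2 hQ0)).2 fun y hy => ?_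
    refine (le_trans (mul_le_mul_left hQJ _) hIle) ?_
    rw [mul_comm z y, mul_assoc]
    exact FractionalIdeal.mul_mem_mul hy hz
  refine le_antisymm ((st.mono _ _ hQle).trans_eq st.map_one) ?_
  have hI' : st ((I : FractionalIdeal R⁰ K) * (I : FractionalIdeal R⁰ K)⁻¹) = 1 := hI
  rw [← hI', ← st.idem ((Q : FractionalIdeal R⁰ K) * _)]
  refine st.mono _ _ ?_
  have h1 : (I : FractionalIdeal R⁰ K) = st ((Q : FractionalIdeal R⁰ K) * J) := by
    rw [← FractionalIdeal.coeIdeal_mul, star_coeIdeal, h]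
  calc (I : FractionalIdeal R⁰ K) * (I : FractionalIdeal R⁰ K)⁻¹
      = (I : FractionalIdeal R⁰ K)⁻¹ * st ((Q : FractionalIdeal R⁰ K) * J) := by
        rw [← h1, mul_comm]
    _ ≤ st ((I : FractionalIdeal R⁰ K)⁻¹ * ((Q : FractionalIdeal R⁰ K) * J)) :=
        st.mul_star_le _ _
    _ ≤ st ((Q : FractionalIdeal R⁰ K) * (Q : FractionalIdeal R⁰ K)⁻¹) := by
        refine st.mono _ _ ?_
        rw [mul_comm, mul_assoc]
        exact mul_le_mul' le_rfl hJinv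

theorem isURD_of_exists_factorization (hst : st.IsFiniteType)
    (h : ∀ I : Ideal R, st.IsProperStarIdeal I →
      ∃ s : Multiset (Ideal R), st.IsPrimeRadicalFactorization I s) : st.IsURD := by
  intro I hI hinv
  obtain ⟨s, hs⟩ := h I hI
  refine ⟨s, ⟨fun Q hQ => ⟨(hs.1 Q hQ).1, ?_,
    existsUnique_minimalPrime_of_radical_isPrime (hs.1 Q hQ).2⟩, hs.2⟩, fun t ht =>
    ht.isPrimeRadicalFactorization.unique hst hs⟩
  obtain ⟨t, rfl⟩ := Multiset.exists_cons_of_mem hQ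
  refine hinv.of_closure_mul_eq hI.1.1 (J := t.prod) ?_
  rw [← Multiset.prod_cons]
  exact hs.closure_prod

end

end StarOperation

theorem mainTheorem11 {R : Type*} [CommRing R] [IsDomain R] {K : Type*} [Field K]
    [Algebra R K] [IsFractionRing R K] (st : StarOperation R K) (hst : st.IsFiniteType) :
    List.TFAE
      [st.IsTreed ∧ ∀ I : Ideal R, st.IsProperStarIdeal I → I.minimalPrimes.Finite,
        ∀ I : Ideal R, st.IsProperStarIdeal I →
          ∃ s : Multiset (Ideal R), st.IsPrimeRadicalFactorization I s,
        ∀ I : Ideal R, st.IsProperStarIdeal I →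
          ∃! s : Multiset (Ideal R), st.IsPrimeRadicalFactorization I s] ∧
    ((st.IsTreed ∧ ∀ I : Ideal R, st.IsProperStarIdeal I → I.minimalPrimes.Finite) →
      st.IsURD) ∧
    ((∀ I : Ideal R, st.IsProperStarIdeal I →
        ∃ s : Multiset (Ideal R), st.IsPrimeRadicalFactorization I s) →
      st.IsURD) := by
  have h12 : (st.IsTreed ∧ ∀ I : Ideal R, st.IsProperStarIdeal I → I.minimalPrimes.Finite) →
      ∀ I : Ideal R, st.IsProperStarIdeal I →
        ∃ s : Multiset (Ideal R), st.IsPrimeRadicalFactorization I s :=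
    fun h I hI => StarOperation.exists_factorization_of_treed hst h.1 hI.1 (h.2 I hI)
  refine ⟨?_, fun h => StarOperation.isURD_of_exists_factorization hst (h12 h),
    StarOperation.isURD_of_exists_factorization hst⟩
  tfae_have 1 → 2 := h12
  tfae_have 2 → 1 := fun h => ⟨StarOperation.isTreed_of_exists_factorization h, fun I hI =>
    (h I hI).elim fun _ hs => hs.finite_minimalPrimes⟩
  tfae_have 2 → 3 := fun h I hI =>
    (h I hI).elim fun s hs => ⟨s, hs, fun _ ht => ht.unique hst hs⟩
  tfae_have 3 → 2 := fun h I hI => (h I hI).exists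
  tfae_finish
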